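/- Let $(S_n^{(1)}, S_n^{(2)})_{n\ge 0}$ be a bivariate random walk, that is, a sequence of random vectors in $\mathbb{R}^2$ with $(S_0^{(1)},S_0^{(2)})=(0,0)$ almost surely and with independent identically distributed increments, and suppose that $(S_1^{(1)}, S_1^{(2)})$ and $(S_1^{(1)}, -S_1^{(2)})$ have the same distribution. Then for every $n \ge 1$ and every Borel set $B \subset \mathbb{R}$, $$\mathbb{P}\Bigl\{ S_n^{(1)} \in B,\ \min_{1 \le i \le n} S_i^{(2)} \ge 0 \Bigr\} \ge \mathbb{P}\bigl\{ S_n^{(1)} \in B \bigr\}\, \mathbb{P}\Bigl\{ \min_{1 \le i \le n} S_i^{(2)} > 0 \Bigr\}$$ and $$\mathbb{P}\Bigl\{ S_n^{(1)} \in B,\ \min_{1 \le i \le n} S_i^{(2)} > 0 \Bigr\} \le \mathbb{P}\bigl\{ S_n^{(1)} \in B \bigr\}\, \mathbb{P}\Bigl\{ \min_{1 \le i \le n} S_i^{(2)} \ge 0 \Bigr\}.$$ Moreover, if the distribution of $S_1^{(2)}$ is continuous, that is, has no atoms, then for every $n \ge 1$ and every Borel set $B \subset \mathbb{R}$ the events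 $\{S_n^{(1)} \in B\}$ and $\{\min_{1 \le i \le n} S_i^{(2)} > 0\}$ are independent. -/

import Mathlib

open MeasureTheory ProbabilityTheory

/-- `S` is a random walk in the plane under `P`: it starts at the origin almost surely and its
increments are independent and identically distributed. -/
structure IsBivariateRandomWalk {Ω : Type*} [MeasurableSpace Ω] (S : ℕ → Ω → ℝ × ℝ)
    (P : Measure Ω) : Prop where
  measurable : ∀ n, Measurable (S n)
  start : ∀ᵐ ω ∂P, S 0 ω = 0
  indep : iIndepFun (fun (n : ℕ) (ω : Ω) => S (n + 1) ω - S n ω) P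
  identDistrib : ∀ n : ℕ,
    IdentDistrib (fun ω => S (n + 1) ω - S n ω) (fun ω => S 1 ω - S 0 ω) P P

/-- `min_{1 ≤ i ≤ n} S_i^{(2)}`, for `n ≥ 1`. -/
noncomputable def minSnd {Ω : Type*} (S : ℕ → Ω → ℝ × ℝ) (n : ℕ) (hn : 1 ≤ n) (ω : Ω) : ℝ :=
  (Finset.Icc 1 n).inf' (Finset.nonempty_Icc.mpr hn) (fun i => (S i ω).2)

/-! Give each step an independent Gaussian mark `u` and order the pairs `(y, u)` lexicographically.
Almost surely ties disappear, while negating `(y, u)` still preserves the step law and fixes `x`.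
Split according to the time `k` of the strict maximum of the walk up to time `n`. Reversing the
steps before `k` and reflecting those after it turns the maximum event into two independent walks
staying positive, of lengths `k` and `n - k`, whose endpoint first coordinates add up to the
original one (`reverseSplice_mem_maxAtWalks_iff`, `lintegral_maxAtWalks`). Let `A` be the event that
the marked walk stays positive. By strong induction the terms `0 < k < n` factor, with total `C * E
g`. The terms `k = 0` and `k = n` both equal `E[g; A]`, so `E g = 2 E[g; A] + C E g`. Comparison
with `g = 1` gives `E[g; A] = P(A) E g` (`setLIntegral_posWalks`). Since `A` lies between strict and
weak positivity of the unmarked walk, both inequalities follow. Without atoms the two positivity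
events agree almost surely, and independence results. -/

/-- The coordinates of an infinite product measure are jointly independent along any finite
injective reindexing. -/
lemma infinitePi_setOf_forall_mem {ι E : Type*} [MeasurableSpace E] (ν : Measure E)
    [IsProbabilityMeasure ν] (s : Finset ι) (f : ι → ℕ) (hf : Set.InjOn f s)
    (t : ι → Set E) (ht : ∀ i, MeasurableSet (t i)) :
    Measure.infinitePi (fun _ : ℕ => ν) {v | ∀ i ∈ s, v (f i) ∈ t i} = ∏ i ∈ s, ν (t i) := by
  have hinj : Function.Injective (fun i : s => f i) := fun i j h =>
    Subtype.ext (hf i.2 j.2 h)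
  have h := (iIndepFun_infinitePi (P := fun _ : ℕ => ν) (X := fun _ e => e)
    (fun _ => measurable_id)).precomp hinj
  have h2 := h.meas_iInter (s := fun i : s => (fun v : ℕ → E => v (f i)) ⁻¹' t i)
    (fun i => ⟨t i, ht i, rfl⟩)
  have hset : {v : ℕ → E | ∀ i ∈ s, v (f i) ∈ t i}
      = ⋂ i : s, (fun v : ℕ → E => v (f i)) ⁻¹' t i := by
    ext v; simp
  rw [hset, h2, ← Finset.prod_coe_sort s]
  refine Finset.prod_congr rfl fun i _ => ?_
  exact (measurePreserving_eval_infinitePi (fun _ : ℕ => ν) (f i)).measure_preimage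
    (ht i).nullMeasurableSet

/-! ### Splicing i.i.d. sequences, and sums without atoms -/

/-- The sequence whose first `k` terms are the first `k` terms of `p.1` in reverse order, and whose
remaining terms are the images under `τ` of the terms of `p.2`. -/
def reverseSplice {E : Type*} (τ : E → E) (k : ℕ) (p : (ℕ → E) × (ℕ → E)) : ℕ → E :=
  fun i => if i < k then p.1 (k - 1 - i) else τ (p.2 (i - k))

lemma measurable_reverseSplice {E : Type*} [MeasurableSpace E] {τ : E → E} (hτ : Measurable τ)
    (k : ℕ) : Measurable (reverseSplice τ k) := by
  refine measurable_pi_iff.2 fun i => ?_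
  unfold reverseSplice
  split_ifs
  · fun_prop
  · fun_prop

/-- Each output coordinate reads its own input coordinate, so a cylinder pulls back to a product of
two cylinders; `τ` does not change the law of a single step. -/
lemma measurePreserving_reverseSplice {E : Type*} [MeasurableSpace E] (ν : Measure E)
    [IsProbabilityMeasure ν] {τ : E → E} (hτ : MeasurePreserving τ ν ν) (k : ℕ) :
    MeasurePreserving (reverseSplice τ k)
      ((Measure.infinitePi fun _ : ℕ => ν).prod (Measure.infinitePi fun _ : ℕ => ν))
      (Measure.infinitePi fun _ : ℕ => ν) := by
  refine ⟨measurable_reverseSplice hτ.measurable k, Measure.eq_infinitePi _ fun s t ht => ?_⟩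
  rw [Measure.map_apply (measurable_reverseSplice hτ.measurable k)
    (.pi s.countable_toSet fun i _ => ht i)]
  have hset : reverseSplice τ k ⁻¹' (Set.pi s t)
      = {v | ∀ i ∈ s.filter (· < k), v (k - 1 - i) ∈ t i} ×ˢ
        {w | ∀ i ∈ s.filter (¬ · < k), w (i - k) ∈ τ ⁻¹' t i} := by
    ext ⟨v, w⟩
    simp only [reverseSplice, Set.mem_preimage, Set.mem_pi, Finset.mem_coe, Set.mem_prod,
      Set.mem_ofPred_eq, Finset.mem_filter]
    constructor
    · intro h
      refine ⟨fun i hi => ?_, fun i hi => ?_⟩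
      · simpa [hi.2] using h i hi.1
      · simpa [hi.2] using h i hi.1
    · rintro ⟨h1, h2⟩ i hi
      split_ifs with hk
      · exact h1 i ⟨hi, hk⟩
      · exact h2 i ⟨hi, hk⟩
  rw [hset, Measure.prod_prod, infinitePi_setOf_forall_mem ν _ _ _ t ht,
    infinitePi_setOf_forall_mem ν _ _ _ _ (fun i => hτ.measurable (ht i)),
    ← Finset.prod_filter_mul_prod_filter_not s (· < k)]
  · congr 1
    exact Finset.prod_congr rfl fun i _ => hτ.measure_preimage (ht i).nullMeasurableSet
  · intro i hi j hj h
    simp only [Finset.coe_filter, Set.mem_ofPred_eq] at hi hj h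
    omega
  · intro i hi j hj h
    simp only [Finset.coe_filter, Set.mem_ofPred_eq] at hi hj h
    omega

lemma sum_Ico_reverseSplice {E : Type*} [AddCommMonoid E] (τ : E → E) {j k : ℕ} (hj : j ≤ k)
    (p : (ℕ → E) × (ℕ → E)) :
    ∑ i ∈ Finset.Ico j k, reverseSplice τ k p i = ∑ i ∈ Finset.range (k - j), p.1 i := by
  rw [Finset.sum_Ico_eq_sum_range, ← Finset.sum_range_reflect]
  refine Finset.sum_congr rfl fun i hi => ?_
  rw [Finset.mem_range] at hi
  have h1 : j + (k - j - 1 - i) < k := by omega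
  have h2 : k - 1 - (j + (k - j - 1 - i)) = i := by omega
  simp only [reverseSplice, h1, if_true, h2]

lemma sum_Ico_add_reverseSplice {E : Type*} [AddCommMonoid E] (τ : E →+ E) (k m : ℕ)
    (p : (ℕ → E) × (ℕ → E)) :
    ∑ i ∈ Finset.Ico k (k + m), reverseSplice τ k p i
      = τ (∑ i ∈ Finset.range m, p.2 i) := by
  rw [Finset.sum_Ico_eq_sum_range, map_sum, Nat.add_sub_cancel_left]
  refine Finset.sum_congr rfl fun i _ => ?_
  simp [reverseSplice]

/-- A nonempty sum of i.i.d. real variables with atomless law almost surely does not vanish. -/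
lemma infinitePi_ae_sum_ne_zero {E : Type*} [MeasurableSpace E] (ν : Measure E)
    [IsProbabilityMeasure ν] (φ : E → ℝ) (hφ : Measurable φ) (hν : ∀ a, ν.map φ {a} = 0)
    (s : Finset ℕ) (hs : s.Nonempty) :
    ∀ᵐ v ∂(Measure.infinitePi fun _ : ℕ => ν), ∑ i ∈ s, φ (v i) ≠ 0 := by
  obtain ⟨j, hj⟩ := hs
  set μ := Measure.infinitePi fun _ : ℕ => ν
  have hm : ∀ i : ℕ, Measurable fun v : ℕ → E => φ (v i) := fun i => by fun_prop
  -- Isolate one term: given the others, the sum vanishes only if that term takes a single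
  -- prescribed value.
  have hind : IndepFun (∑ i ∈ s.erase j, fun v : ℕ → E => φ (v i)) (fun v => φ (v j)) μ :=
    iIndepFun.indepFun_finsetSum_of_notMem
      (iIndepFun_infinitePi (P := fun _ : ℕ => ν) (X := fun _ e => φ e) (fun _ => hφ)) hm
      (Finset.notMem_erase j s)
  have hR : Measurable (∑ i ∈ s.erase j, fun v : ℕ → E => φ (v i)) := by
    have := Finset.measurable_sum (s.erase j) fun i _ => hm i
    simpa only [Finset.sum_fn] using this
  have hlaw : μ.map (fun v => φ (v j)) = ν.map φ := by
    have h := (measurePreserving_eval_infinitePi (fun _ : ℕ => ν) j).map_eq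
    rw [← h, Measure.map_map hφ (by fun_prop)]
    rfl
  rw [indepFun_iff_map_prod_eq_prod_map_map hR.aemeasurable (hm j).aemeasurable, hlaw] at hind
  have : IsProbabilityMeasure (ν.map φ) := Measure.isProbabilityMeasure_map hφ.aemeasurable
  have hD : MeasurableSet {q : ℝ × ℝ | q.1 + q.2 = 0} :=
    measurableSet_eq_fun (by fun_prop) measurable_const
  have h0 : μ {v | ∑ i ∈ s, φ (v i) = 0} = 0 := by
    have hset : {v : ℕ → E | ∑ i ∈ s, φ (v i) = 0}
        = (fun v => ((∑ i ∈ s.erase j, fun v : ℕ → E => φ (v i)) v, φ (v j))) ⁻¹'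
          {q : ℝ × ℝ | q.1 + q.2 = 0} := by
      ext v
      simp only [Set.mem_ofPred_eq, Set.mem_preimage, Finset.sum_apply]
      rw [Finset.sum_erase_add _ _ hj]
    rw [hset, ← Measure.map_apply (hR.prodMk (hm j)) hD, hind, Measure.prod_apply hD]
    refine lintegral_eq_zero_of_ae_eq_zero (Filter.Eventually.of_forall fun x => ?_)
    have : Prod.mk x ⁻¹' {q : ℝ × ℝ | q.1 + q.2 = 0} = {-x} := by
      ext y
      simp [eq_neg_iff_add_eq_zero, add_comm]
    simp only [this, hν, Pi.zero_apply]
  exact measure_eq_zero_iff_ae_notMem.1 h0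

/-! ### Lexicographic positivity and reflection -/

/-- The reflection of a step `((x, y), u)` that keeps `x` and negates `(y, u)`. -/
def reflectStep : ((ℝ × ℝ) × ℝ) →+ ((ℝ × ℝ) × ℝ) where
  toFun e := ((e.1.1, -e.1.2), -e.2)
  map_zero' := by simp
  map_add' a b := by
    ext <;> simp <;> ring

@[simp] lemma reflectStep_apply (e : (ℝ × ℝ) × ℝ) :
    reflectStep e = ((e.1.1, -e.1.2), -e.2) := rfl

/-- The last two coordinates `(y, u)` of `((x, y), u)` are lexicographically positive. -/
def LexPos (e : (ℝ × ℝ) × ℝ) : Prop := 0 < e.1.2 ∨ (e.1.2 = 0 ∧ 0 < e.2)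

lemma measurableSet_lexPos : MeasurableSet {e | LexPos e} := by
  unfold LexPos
  have h1 : MeasurableSet {e : (ℝ × ℝ) × ℝ | 0 < e.1.2} :=
    measurableSet_lt measurable_const (by fun_prop)
  have h2 : MeasurableSet {e : (ℝ × ℝ) × ℝ | e.1.2 = 0} :=
    measurableSet_eq_fun (by fun_prop) measurable_const
  have h3 : MeasurableSet {e : (ℝ × ℝ) × ℝ | 0 < e.2} :=
    measurableSet_lt measurable_const (by fun_prop)
  exact h1.union (h2.inter h3)

lemma LexPos.add {a b : (ℝ × ℝ) × ℝ} (ha : LexPos a) (hb : LexPos b) : LexPos (a + b) := by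
  simp only [LexPos, Prod.fst_add, Prod.snd_add] at *
  rcases ha with ha | ⟨ha, ha'⟩ <;> rcases hb with hb | ⟨hb, hb'⟩
  · left; linarith
  · left; linarith
  · left; linarith
  · right; constructor <;> linarith

lemma LexPos.of_add_of_reflectStep {a b : (ℝ × ℝ) × ℝ} (h : LexPos (a + b))
    (ha : LexPos (reflectStep a)) : LexPos b := by
  simp only [LexPos, Prod.fst_add, Prod.snd_add, reflectStep_apply] at *
  rcases h with h | ⟨h, h'⟩ <;> rcases ha with ha | ⟨ha, ha'⟩
  · left; linarith
  · left; linarith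
  · left; linarith
  · right; constructor <;> linarith

lemma LexPos.not_reflectStep {a : (ℝ × ℝ) × ℝ} (h : LexPos a) : ¬ LexPos (reflectStep a) := by
  intro h'
  simp only [LexPos, reflectStep_apply] at *
  rcases h with h | ⟨h, _⟩ <;> rcases h' with h' | ⟨h', _⟩ <;> linarith

lemma lexPos_or_reflectStep {a : (ℝ × ℝ) × ℝ} (h : a.2 ≠ 0) :
    LexPos a ∨ LexPos (reflectStep a) := by
  simp only [LexPos, reflectStep_apply]
  rcases lt_trichotomy a.1.2 0 with h1 | h1 | h1
  · right; left; linarith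
  · rcases lt_or_gt_of_ne h with h2 | h2
    · right; right; constructor <;> linarith
    · left; right; exact ⟨h1, h2⟩
  · left; left; exact h1

/-! ### The time of the maximum -/

/-- The walk with steps `v` has lexicographically positive positions at the times `1, …, k`. -/
def posWalks (k : ℕ) : Set (ℕ → (ℝ × ℝ) × ℝ) :=
  {v | ∀ j, 1 ≤ j → j ≤ k → LexPos (∑ i ∈ Finset.range j, v i)}

/-- The walk with steps `v`, observed at the times `0, …, n`, attains its strict lexicographic
maximum at time `k`. -/
def maxAtWalks (k n : ℕ) : Set (ℕ → (ℝ × ℝ) × ℝ) :=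
  {v | (∀ j, j < k → LexPos (∑ i ∈ Finset.Ico j k, v i)) ∧
    ∀ j, k < j → j ≤ n → LexPos (reflectStep (∑ i ∈ Finset.Ico k j, v i))}

lemma measurable_reflectStep : Measurable reflectStep := by
  change Measurable fun e : (ℝ × ℝ) × ℝ => ((e.1.1, -e.1.2), -e.2)
  fun_prop

lemma measurableSet_posWalks (k : ℕ) : MeasurableSet (posWalks k) := by
  simp only [posWalks, Set.ofPred_forall]
  refine .iInter fun j => .iInter fun _ => .iInter fun _ => ?_
  exact (Finset.measurable_sum _ fun i _ => measurable_pi_apply i) measurableSet_lexPos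

lemma measurableSet_maxAtWalks (k n : ℕ) : MeasurableSet (maxAtWalks k n) := by
  simp only [maxAtWalks, Set.ofPred_and, Set.ofPred_forall]
  refine .inter (.iInter fun j => .iInter fun _ => ?_)
    (.iInter fun j => .iInter fun _ => .iInter fun _ => ?_)
  · exact (Finset.measurable_sum _ fun i _ => measurable_pi_apply i) measurableSet_lexPos
  · exact (measurable_reflectStep.comp (Finset.measurable_sum _ fun i _ => measurable_pi_apply i))
      measurableSet_lexPos

lemma exists_mem_maxAtWalks (v : ℕ → (ℝ × ℝ) × ℝ)
    (hv : ∀ j k, j < k → (∑ i ∈ Finset.Ico j k, v i).2 ≠ 0) (n : ℕ) :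
    ∃ k ≤ n, v ∈ maxAtWalks k n := by
  induction n with
  | zero => exact ⟨0, le_rfl, fun j hj => by omega, fun j _ _ => by omega⟩
  | succ n ih =>
    obtain ⟨k, hk, h1, h2⟩ := ih
    -- Compare the new endpoint with the old maximum: either it becomes the maximum or the old one
    -- remains.
    rcases lexPos_or_reflectStep (hv k (n + 1) (by omega)) with h | h
    · refine ⟨n + 1, le_rfl, fun j hj => ?_, fun j _ _ => by omega⟩
      rcases lt_trichotomy j k with hjk | rfl | hjk
      · rw [← Finset.sum_Ico_consecutive v hjk.le (by omega : k ≤ n + 1)]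
        exact (h1 j hjk).add h
      · exact h
      · rw [← Finset.sum_Ico_consecutive v hjk.le hj.le] at h
        exact h.of_add_of_reflectStep (h2 j hjk (by omega))
    · refine ⟨k, by omega, h1, fun j hj hjn => ?_⟩
      rcases Nat.lt_or_ge n j with hj' | hj'
      · obtain rfl : j = n + 1 := by omega
        exact h
      · exact h2 j hj hj'

lemma eq_of_mem_maxAtWalks {v : ℕ → (ℝ × ℝ) × ℝ} {k l n : ℕ} (hk : k ≤ n) (hl : l ≤ n)
    (hvk : v ∈ maxAtWalks k n) (hvl : v ∈ maxAtWalks l n) : k = l := by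
  rcases lt_trichotomy k l with h | h | h
  · exact absurd (hvk.2 l h hl) (hvl.1 k h).not_reflectStep
  · exact h
  · exact absurd (hvl.2 k h hk) (hvk.1 l h).not_reflectStep

lemma sum_indicator_maxAtWalks (v : ℕ → (ℝ × ℝ) × ℝ)
    (hv : ∀ j k, j < k → (∑ i ∈ Finset.Ico j k, v i).2 ≠ 0) (n : ℕ)
    (g : (ℕ → (ℝ × ℝ) × ℝ) → ENNReal) :
    ∑ k ∈ Finset.range (n + 1), (maxAtWalks k n).indicator g v = g v := by
  obtain ⟨k, hk, h⟩ := exists_mem_maxAtWalks v hv n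
  rw [Finset.sum_eq_single_of_mem k (Finset.mem_range.2 (by omega)), Set.indicator_of_mem h]
  intro l hl hlk
  refine Set.indicator_of_notMem (fun h' => hlk ?_) _
  exact eq_of_mem_maxAtWalks (by rw [Finset.mem_range] at hl; omega) hk h' h

/-- Reversal turns increments ending at time `k` into positions of `v`. Reflection turns the drop
below the maximum after time `k` into positivity of `w`. -/
lemma reverseSplice_mem_maxAtWalks_iff (k m : ℕ) (v w : ℕ → (ℝ × ℝ) × ℝ) :
    reverseSplice reflectStep k (v, w) ∈ maxAtWalks k (k + m)
      ↔ v ∈ posWalks k ∧ w ∈ posWalks m := by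
  have hinv : ∀ e, reflectStep (reflectStep e) = e := fun e => by simp
  refine and_congr ⟨fun h j hj hjk => ?_, fun h j hj => ?_⟩
    ⟨fun h j hj hjm => ?_, fun h j hj hjm => ?_⟩
  · have := h (k - j) (by omega)
    rwa [sum_Ico_reverseSplice _ (by omega), Nat.sub_sub_self hjk] at this
  · rw [sum_Ico_reverseSplice _ hj.le]
    exact h _ (by omega) (by omega)
  · have := h (k + j) (by omega) (by omega)
    rwa [sum_Ico_add_reverseSplice, hinv] at this
  · obtain ⟨d, rfl⟩ := Nat.exists_eq_add_of_le hj.le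
    rw [sum_Ico_add_reverseSplice, hinv]
    exact h d (by omega) (by omega)

lemma sum_fst_fst_reverseSplice (k m : ℕ) (v w : ℕ → (ℝ × ℝ) × ℝ) :
    (∑ i ∈ Finset.range (k + m), reverseSplice reflectStep k (v, w) i).1.1
      = (∑ i ∈ Finset.range k, v i).1.1 + (∑ i ∈ Finset.range m, w i).1.1 := by
  rw [Finset.range_eq_Ico, ← Finset.sum_Ico_consecutive _ (Nat.zero_le k) (Nat.le_add_right k m),
    sum_Ico_reverseSplice _ (Nat.zero_le k), sum_Ico_add_reverseSplice]
  simp only [Prod.fst_add, Nat.sub_zero, reflectStep_apply]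

lemma measurable_sum_fst_fst (n : ℕ) :
    Measurable fun v : ℕ → (ℝ × ℝ) × ℝ => (∑ i ∈ Finset.range n, v i).1.1 :=
  (Finset.measurable_sum _ fun i _ => measurable_pi_apply i).fst.fst

lemma measurable_comp_sum_fst_fst {g : ℝ → ENNReal} (hg : Measurable g) (n : ℕ) :
    Measurable fun v : ℕ → (ℝ × ℝ) × ℝ => g (∑ i ∈ Finset.range n, v i).1.1 :=
  hg.comp (measurable_sum_fst_fst n)

/-! ### Independence for the tie-free symmetric walk -/

section

variable {ν : Measure ((ℝ × ℝ) × ℝ)} [IsProbabilityMeasure ν]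

/-- The same splice as for the maximum serves here, since neither reversal nor reflection alters the
sum of first coordinates. -/
lemma lintegral_comp_sum_add (hν : MeasurePreserving reflectStep ν ν) (k m : ℕ)
    {g : ℝ → ENNReal} (hg : Measurable g) :
    ∫⁻ v, g (∑ i ∈ Finset.range (k + m), v i).1.1 ∂(Measure.infinitePi fun _ : ℕ => ν)
      = ∫⁻ v, ∫⁻ w, g ((∑ i ∈ Finset.range k, v i).1.1 + (∑ i ∈ Finset.range m, w i).1.1)
        ∂(Measure.infinitePi fun _ : ℕ => ν) ∂(Measure.infinitePi fun _ : ℕ => ν) := by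
  have hI := measurable_comp_sum_fst_fst hg (k + m)
  have hT := hI.comp (measurable_reverseSplice hν.measurable k)
  rw [← (measurePreserving_reverseSplice ν hν k).lintegral_comp hI,
    lintegral_prod _ (by exact hT.aemeasurable)]
  simp only [sum_fst_fst_reverseSplice]

lemma lintegral_maxAtWalks (hν : MeasurePreserving reflectStep ν ν) (k m : ℕ)
    {g : ℝ → ENNReal} (hg : Measurable g) :
    ∫⁻ v, (maxAtWalks k (k + m)).indicator
        (fun v => g (∑ i ∈ Finset.range (k + m), v i).1.1) v
        ∂(Measure.infinitePi fun _ : ℕ => ν)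
      = ∫⁻ v in posWalks k, ∫⁻ w in posWalks m,
          g ((∑ i ∈ Finset.range k, v i).1.1 + (∑ i ∈ Finset.range m, w i).1.1)
        ∂(Measure.infinitePi fun _ : ℕ => ν) ∂(Measure.infinitePi fun _ : ℕ => ν) := by
  have hI : Measurable ((maxAtWalks k (k + m)).indicator
      (fun v => g (∑ i ∈ Finset.range (k + m), v i).1.1)) :=
    (measurable_comp_sum_fst_fst hg (k + m)).indicator (measurableSet_maxAtWalks k (k + m))
  have hT := hI.comp (measurable_reverseSplice hν.measurable k)
  rw [← (measurePreserving_reverseSplice ν hν k).lintegral_comp hI,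
    lintegral_prod _ (by exact hT.aemeasurable),
    ← lintegral_indicator (measurableSet_posWalks k)]
  refine lintegral_congr fun v => ?_
  by_cases hv : v ∈ posWalks k
  · rw [Set.indicator_of_mem hv, ← lintegral_indicator (measurableSet_posWalks m)]
    refine lintegral_congr fun w => ?_
    by_cases hw : w ∈ posWalks m
    · rw [Set.indicator_of_mem hw,
        Set.indicator_of_mem ((reverseSplice_mem_maxAtWalks_iff k m v w).2 ⟨hv, hw⟩),
        sum_fst_fst_reverseSplice]
    · rw [Set.indicator_of_notMem hw, Set.indicator_of_notMem]
      exact fun h => hw ((reverseSplice_mem_maxAtWalks_iff k m v w).1 h).2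
  · rw [Set.indicator_of_notMem hv]
    refine (lintegral_congr fun w => ?_).trans lintegral_zero
    rw [Set.indicator_of_notMem]
    exact fun h => hv ((reverseSplice_mem_maxAtWalks_iff k m v w).1 h).1

lemma posWalks_zero : posWalks 0 = Set.univ :=
  Set.eq_univ_of_forall fun v j hj hj' => by omega

/-- Decomposition of a walk at the time of its maximum. -/
lemma lintegral_comp_sum_eq_sum_maxAtWalks (hu : ∀ a, ν.map Prod.snd {a} = 0) (n : ℕ)
    {g : ℝ → ENNReal} (hg : Measurable g) :
    ∫⁻ v, g (∑ i ∈ Finset.range n, v i).1.1 ∂(Measure.infinitePi fun _ : ℕ => ν)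
      = ∑ k ∈ Finset.range (n + 1), ∫⁻ v, (maxAtWalks k n).indicator
        (fun v => g (∑ i ∈ Finset.range n, v i).1.1) v ∂(Measure.infinitePi fun _ : ℕ => ν) := by
  rw [← lintegral_finsetSum _ fun k _ =>
    (measurable_comp_sum_fst_fst hg n).indicator (measurableSet_maxAtWalks k n)]
  refine lintegral_congr_ae ?_
  -- Nonvanishing of the mark sums alone excludes all ties; `y` may have atoms.
  have hne : ∀ᵐ v ∂(Measure.infinitePi fun _ : ℕ => ν), ∀ j k : ℕ, j < k →
      ∑ i ∈ Finset.Ico j k, (v i).2 ≠ 0 := by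
    simp only [ae_all_iff]
    exact fun j k hjk => infinitePi_ae_sum_ne_zero ν Prod.snd measurable_snd hu _
      (Finset.nonempty_Ico.2 hjk)
  filter_upwards [hne] with v hv
  refine (sum_indicator_maxAtWalks v (fun j k hjk => ?_) n
    (fun v => g (∑ i ∈ Finset.range n, v i).1.1)).symm
  rw [Prod.snd_sum]
  exact hv j k hjk

/-- The event that the walk stays positive is independent of the first coordinate of its
endpoint. -/
lemma setLIntegral_posWalks (hν : MeasurePreserving reflectStep ν ν)
    (hu : ∀ a, ν.map Prod.snd {a} = 0) (n : ℕ) :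
    ∀ g : ℝ → ENNReal, Measurable g → (∀ x, g x ≤ 1) →
    ∫⁻ v in posWalks n, g (∑ i ∈ Finset.range n, v i).1.1 ∂(Measure.infinitePi fun _ : ℕ => ν)
      = (Measure.infinitePi fun _ : ℕ => ν) (posWalks n) *
        ∫⁻ v, g (∑ i ∈ Finset.range n, v i).1.1 ∂(Measure.infinitePi fun _ : ℕ => ν) := by
  set μ := Measure.infinitePi fun _ : ℕ => ν with hμ
  induction n using Nat.strong_induction_on with
  | _ n ih =>
  rcases Nat.eq_zero_or_pos n with rfl | hn
  · intro g _ _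
    simp [posWalks_zero]
  set C : ENNReal := ∑ k ∈ Finset.Ico 1 n, μ (posWalks k) * μ (posWalks (n - k)) with hC
  have hX := measurable_sum_fst_fst
  have hmid : ∀ g : ℝ → ENNReal, Measurable g → (∀ x, g x ≤ 1) → ∀ k ∈ Finset.Ico 1 n,
      ∫⁻ v, (maxAtWalks k n).indicator (fun v => g (∑ i ∈ Finset.range n, v i).1.1) v ∂μ
        = μ (posWalks k) * μ (posWalks (n - k)) *
          ∫⁻ v, g (∑ i ∈ Finset.range n, v i).1.1 ∂μ := by
    intro g hg hg1 k hk
    rw [Finset.mem_Ico] at hk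
    obtain ⟨m, rfl⟩ := Nat.exists_eq_add_of_le hk.2.le
    rw [lintegral_maxAtWalks hν k m hg, lintegral_comp_sum_add hν k m hg, Nat.add_sub_cancel_left,
      ← hμ]
    -- The induction hypothesis is used twice: for the translates of `g` on the second walk, then
    -- for this averaged function on the first. Hence the statement ranges over functions `g`, not
    -- just sets.
    have hh : Measurable fun x : ℝ => ∫⁻ w, g (x + (∑ i ∈ Finset.range m, w i).1.1) ∂μ :=
      Measurable.lintegral_prod_right' (f := fun q : ℝ × (ℕ → (ℝ × ℝ) × ℝ) =>
        g (q.1 + (∑ i ∈ Finset.range m, q.2 i).1.1))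
        (hg.comp (measurable_fst.add ((hX m).comp measurable_snd)))
    have hh1 : ∀ x : ℝ, ∫⁻ w, g (x + (∑ i ∈ Finset.range m, w i).1.1) ∂μ ≤ 1 := fun x =>
      (lintegral_mono fun w => hg1 _).trans (by simp)
    have hin : ∀ v : ℕ → (ℝ × ℝ) × ℝ, ∫⁻ w in posWalks m,
        g ((∑ i ∈ Finset.range k, v i).1.1 + (∑ i ∈ Finset.range m, w i).1.1) ∂μ
        = μ (posWalks m) * ∫⁻ w,
          g ((∑ i ∈ Finset.range k, v i).1.1 + (∑ i ∈ Finset.range m, w i).1.1) ∂μ := fun v =>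
      ih m (by omega) (fun x => g ((∑ i ∈ Finset.range k, v i).1.1 + x))
        (hg.comp (measurable_const_add _)) (fun x => hg1 _)
    have hhX : Measurable fun v : ℕ → (ℝ × ℝ) × ℝ => ∫⁻ w,
        g ((∑ i ∈ Finset.range k, v i).1.1 + (∑ i ∈ Finset.range m, w i).1.1) ∂μ :=
      hh.comp (hX k)
    simp only [hin]
    rw [lintegral_const_mul _ hhX, ih k hk.2 _ hh hh1]
    ring
  have hdec : ∀ g : ℝ → ENNReal, Measurable g → (∀ x, g x ≤ 1) →
      ∫⁻ v, g (∑ i ∈ Finset.range n, v i).1.1 ∂μ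
        = 2 * ∫⁻ v in posWalks n, g (∑ i ∈ Finset.range n, v i).1.1 ∂μ
          + C * ∫⁻ v, g (∑ i ∈ Finset.range n, v i).1.1 ∂μ := by
    intro g hg hg1
    conv_lhs => rw [hμ, lintegral_comp_sum_eq_sum_maxAtWalks hu n hg, ← hμ]
    rw [Finset.sum_range_succ, Finset.sum_range_eq_add_Ico _ hn,
      Finset.sum_congr rfl (hmid g hg hg1), ← Finset.sum_mul, ← hC]
    -- A maximum at time `0` or `n` leaves one walk of length `n` staying positive, which explains
    -- the factor 2.
    have h0 := lintegral_maxAtWalks hν 0 n hg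
    have h1 := lintegral_maxAtWalks hν n 0 hg
    simp only [← hμ, posWalks_zero, Measure.restrict_univ, Finset.range_zero, Finset.sum_empty,
      Prod.fst_zero, zero_add, lintegral_const, measure_univ, mul_one, add_zero] at h0 h1
    rw [h0, h1]
    ring
  intro g hg hg1
  set M := ∫⁻ v, g (∑ i ∈ Finset.range n, v i).1.1 ∂μ
  have hone : 1 = 2 * μ (posWalks n) + C := by
    simpa using hdec (fun _ => 1) measurable_const (fun _ => le_rfl)
  have hM : M ≤ 1 := (lintegral_mono fun w => hg1 _).trans (by simp)
  -- Finiteness of `C * M` permits cancellation in `ENNReal`.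
  have hCle : C ≤ 1 := hone ▸ le_add_self
  have hfin : C * M ≠ ⊤ :=
    ENNReal.mul_ne_top (hCle.trans_lt ENNReal.one_lt_top).ne (hM.trans_lt ENNReal.one_lt_top).ne
  have h1 := hdec g hg hg1
  have h2 : M = 2 * (μ (posWalks n) * M) + C * M := by
    rw [← mul_assoc, ← add_mul, ← hone, one_mul]
  have h3 := (ENNReal.add_left_inj hfin).1 (h1.symm.trans h2)
  exact (ENNReal.mul_right_inj (by simp) (by simp)).1 h3

/-- The endpoint form of `setLIntegral_posWalks` for sets. -/
lemma infinitePi_inter_posWalks (hν : MeasurePreserving reflectStep ν ν)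
    (hu : ∀ a, ν.map Prod.snd {a} = 0) (n : ℕ) {B : Set ℝ} (hB : MeasurableSet B) :
    (Measure.infinitePi fun _ : ℕ => ν) ({v | (∑ i ∈ Finset.range n, v i).1.1 ∈ B} ∩ posWalks n)
      = (Measure.infinitePi fun _ : ℕ => ν) {v | (∑ i ∈ Finset.range n, v i).1.1 ∈ B} *
        (Measure.infinitePi fun _ : ℕ => ν) (posWalks n) := by
  have h := setLIntegral_posWalks hν hu n (B.indicator 1) (measurable_one.indicator hB)
    (fun x => Set.indicator_le_self' (fun _ _ => zero_le) x)
  have hm : MeasurableSet {v : ℕ → (ℝ × ℝ) × ℝ | (∑ i ∈ Finset.range n, v i).1.1 ∈ B} :=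
    measurable_sum_fst_fst n hB
  have hi : ∀ v : ℕ → (ℝ × ℝ) × ℝ, B.indicator (1 : ℝ → ENNReal) (∑ i ∈ Finset.range n, v i).1.1
      = {v : ℕ → (ℝ × ℝ) × ℝ | (∑ i ∈ Finset.range n, v i).1.1 ∈ B}.indicator 1 v :=
    fun v => rfl
  simp only [hi, lintegral_indicator_one hm, Measure.restrict_apply hm] at h
  rw [h, mul_comm]

end

/-! ### Removing the marks -/

lemma measurable_sum_range (n : ℕ) :
    Measurable fun d : ℕ → ℝ × ℝ => ∑ i ∈ Finset.range n, d i :=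
  Finset.measurable_sum _ fun i _ => measurable_pi_apply i

lemma measurableSet_sum_fst_mem (n : ℕ) {B : Set ℝ} (hB : MeasurableSet B) :
    MeasurableSet {d : ℕ → ℝ × ℝ | (∑ i ∈ Finset.range n, d i).1 ∈ B} :=
  (measurable_sum_range n).fst hB

lemma measurableSet_forall_sum_snd_mem (n : ℕ) {C : Set ℝ} (hC : MeasurableSet C) :
    MeasurableSet {d : ℕ → ℝ × ℝ |
      ∀ j ∈ Finset.Icc 1 n, (∑ i ∈ Finset.range j, d i).2 ∈ C} := by
  simp only [Set.ofPred_forall]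
  exact .iInter fun j => .iInter fun _ => (measurable_sum_range j).snd hC

section

variable {ν : Measure (ℝ × ℝ)} [IsProbabilityMeasure ν]

/-- A lexicographic tie-breaking by an independent Gaussian walk yields an event that lies between
strict and weak positivity and is independent of the first coordinate of the endpoint. -/
lemma exists_mul_le_and_le_mul
    (hν : MeasurePreserving (fun z : ℝ × ℝ => (z.1, -z.2)) ν ν) (n : ℕ) {B : Set ℝ}
    (hB : MeasurableSet B) :
    ∃ p : ENNReal,
      (Measure.infinitePi fun _ : ℕ => ν)
          {d | ∀ j ∈ Finset.Icc 1 n, (∑ i ∈ Finset.range j, d i).2 ∈ Set.Ioi 0} ≤ p ∧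
      p ≤ (Measure.infinitePi fun _ : ℕ => ν)
          {d | ∀ j ∈ Finset.Icc 1 n, (∑ i ∈ Finset.range j, d i).2 ∈ Set.Ici 0} ∧
      (Measure.infinitePi fun _ : ℕ => ν) {d | (∑ i ∈ Finset.range n, d i).1 ∈ B} * p ≤
        (Measure.infinitePi fun _ : ℕ => ν) ({d | (∑ i ∈ Finset.range n, d i).1 ∈ B} ∩
          {d | ∀ j ∈ Finset.Icc 1 n, (∑ i ∈ Finset.range j, d i).2 ∈ Set.Ici 0}) ∧
      (Measure.infinitePi fun _ : ℕ => ν) ({d | (∑ i ∈ Finset.range n, d i).1 ∈ B} ∩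
          {d | ∀ j ∈ Finset.Icc 1 n, (∑ i ∈ Finset.range j, d i).2 ∈ Set.Ioi 0}) ≤
        (Measure.infinitePi fun _ : ℕ => ν) {d | (∑ i ∈ Finset.range n, d i).1 ∈ B} * p := by
  set γ := gaussianReal 0 1
  have hγ : MeasurePreserving (fun u : ℝ => -u) γ γ :=
    ⟨measurable_neg, by rw [gaussianReal_map_neg, neg_zero]⟩
  have hνγ : MeasurePreserving reflectStep (ν.prod γ) (ν.prod γ) := hν.prod hγ
  have hu : ∀ a, (ν.prod γ).map Prod.snd {a} = 0 := fun a => by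
    have : NullSingletonClass γ := nullSingletonClass_gaussianReal one_ne_zero
    rw [show (ν.prod γ).map Prod.snd = γ from measurePreserving_snd.map_eq, measure_singleton]
  have hψ : MeasurePreserving (fun (v : ℕ → (ℝ × ℝ) × ℝ) i => (v i).1)
      (Measure.infinitePi fun _ : ℕ => ν.prod γ) (Measure.infinitePi fun _ : ℕ => ν) := by
    refine ⟨by fun_prop, ?_⟩
    rw [Measure.infinitePi_map_pi (μ := fun _ : ℕ => ν.prod γ) (f := fun _ e => e.1)
      (fun _ => measurable_fst)]
    congr 1
    funext i
    exact measurePreserving_fst.map_eq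
  have hind := infinitePi_inter_posWalks hνγ hu n hB
  have hmB := measurableSet_sum_fst_mem n hB
  have hmp := measurableSet_forall_sum_snd_mem n (measurableSet_Ioi (a := (0 : ℝ)))
  have hmn := measurableSet_forall_sum_snd_mem n (measurableSet_Ici (a := (0 : ℝ)))
  have hBset : (fun (v : ℕ → (ℝ × ℝ) × ℝ) i => (v i).1) ⁻¹'
      {d | (∑ i ∈ Finset.range n, d i).1 ∈ B}
      = {v | (∑ i ∈ Finset.range n, v i).1.1 ∈ B} := by
    ext v
    simp only [Set.mem_preimage, Set.mem_ofPred_eq, Prod.fst_sum]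
  have hlow : (fun (v : ℕ → (ℝ × ℝ) × ℝ) i => (v i).1) ⁻¹'
      {d | ∀ j ∈ Finset.Icc 1 n, (∑ i ∈ Finset.range j, d i).2 ∈ Set.Ioi 0} ⊆ posWalks n := by
    intro v hv j hj hjn
    have := hv j (Finset.mem_Icc.2 ⟨hj, hjn⟩)
    rw [← Prod.fst_sum] at this
    exact Or.inl this
  have hupp : posWalks n ⊆ (fun (v : ℕ → (ℝ × ℝ) × ℝ) i => (v i).1) ⁻¹'
      {d | ∀ j ∈ Finset.Icc 1 n, (∑ i ∈ Finset.range j, d i).2 ∈ Set.Ici 0} := by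
    intro v hv j hj
    rw [Finset.mem_Icc] at hj
    have h : 0 ≤ (∑ i ∈ Finset.range j, v i).1.2 := by
      rcases hv j hj.1 hj.2 with h | h
      · exact h.le
      · exact h.1.ge
    rw [Prod.fst_sum] at h
    exact h
  refine ⟨(Measure.infinitePi fun _ : ℕ => ν.prod γ) (posWalks n), ?_, ?_, ?_, ?_⟩
  · rw [← hψ.measure_preimage hmp.nullMeasurableSet]
    exact measure_mono hlow
  · rw [← hψ.measure_preimage hmn.nullMeasurableSet]
    exact measure_mono hupp
  · rw [← hψ.measure_preimage hmB.nullMeasurableSet,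
      ← hψ.measure_preimage (hmB.inter hmn).nullMeasurableSet, Set.preimage_inter, hBset, ← hind]
    exact measure_mono (Set.inter_subset_inter_right _ hupp)
  · rw [← hψ.measure_preimage hmB.nullMeasurableSet,
      ← hψ.measure_preimage (hmB.inter hmp).nullMeasurableSet, Set.preimage_inter, hBset, ← hind]
    exact measure_mono (Set.inter_subset_inter_right _ hlow)

end

/-! ### Transfer to the given walk -/

section

variable {Ω : Type*} [MeasurableSpace Ω] {P : Measure Ω} {S : ℕ → Ω → ℝ × ℝ}

lemma IsBivariateRandomWalk.ae_eq_sum (hS : IsBivariateRandomWalk S P) :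
    ∀ᵐ ω ∂P, ∀ n, S n ω = ∑ i ∈ Finset.range n, (S (i + 1) ω - S i ω) := by
  filter_upwards [hS.start] with ω hω n
  rw [Finset.sum_range_sub (fun i => S i ω), hω, sub_zero]

lemma IsBivariateRandomWalk.map_step (hS : IsBivariateRandomWalk S P) :
    P.map (fun ω => S 1 ω - S 0 ω) = P.map (S 1) := by
  refine Measure.map_congr ?_
  filter_upwards [hS.start] with ω hω
  rw [hω, sub_zero]

/-- Reduces probabilities of walk events to the product space; the start vanishes only almost
surely, so the first increment and `S 1` are identified in law. -/
lemma IsBivariateRandomWalk.measurePreserving_increments [IsProbabilityMeasure P]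
    (hS : IsBivariateRandomWalk S P) :
    MeasurePreserving (fun ω i => S (i + 1) ω - S i ω) P
      (Measure.infinitePi fun _ : ℕ => P.map (S 1)) := by
  have hm : ∀ i, Measurable fun ω => S (i + 1) ω - S i ω := fun i =>
    (hS.measurable (i + 1)).sub (hS.measurable i)
  refine ⟨measurable_pi_iff.2 hm, ?_⟩
  rw [hS.indep.map_fun_eq_infinitePi_map hm]
  congr 1
  funext i
  rw [(hS.identDistrib i).map_eq, hS.map_step]

end

lemma lt_minSnd_iff {Ω : Type*} {S : ℕ → Ω → ℝ × ℝ} {n : ℕ} (hn : 1 ≤ n) (ω : Ω) (a : ℝ) :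
    a < minSnd S n hn ω ↔ ∀ i ∈ Finset.Icc 1 n, a < (S i ω).2 :=
  Finset.lt_inf'_iff _

lemma le_minSnd_iff {Ω : Type*} {S : ℕ → Ω → ℝ × ℝ} {n : ℕ} (hn : 1 ≤ n) (ω : Ω) (a : ℝ) :
    a ≤ minSnd S n hn ω ↔ ∀ i ∈ Finset.Icc 1 n, a ≤ (S i ω).2 :=
  Finset.le_inf'_iff _ _

theorem proposition2 {Ω : Type*} [MeasurableSpace Ω] (P : Measure Ω) [IsProbabilityMeasure P]
    (S : ℕ → Ω → ℝ × ℝ) (hS : IsBivariateRandomWalk S P)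
    (hsymm : IdentDistrib (S 1) (fun ω => ((S 1 ω).1, -(S 1 ω).2)) P P)
    (n : ℕ) (hn : 1 ≤ n) :
    (∀ B : Set ℝ, MeasurableSet B →
      P {ω | (S n ω).1 ∈ B} * P {ω | 0 < minSnd S n hn ω}
        ≤ P {ω | (S n ω).1 ∈ B ∧ 0 ≤ minSnd S n hn ω}) ∧
    (∀ B : Set ℝ, MeasurableSet B →
      P {ω | (S n ω).1 ∈ B ∧ 0 < minSnd S n hn ω}
        ≤ P {ω | (S n ω).1 ∈ B} * P {ω | 0 ≤ minSnd S n hn ω}) ∧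
    ((∀ a : ℝ, P.map (fun ω => (S 1 ω).2) {a} = 0) →
      ∀ B : Set ℝ, MeasurableSet B →
        IndepSet {ω | (S n ω).1 ∈ B} {ω | 0 < minSnd S n hn ω} P) := by
  have : IsProbabilityMeasure (P.map (S 1)) :=
    Measure.isProbabilityMeasure_map (hS.measurable 1).aemeasurable
  have hrefl : MeasurePreserving (fun z : ℝ × ℝ => (z.1, -z.2)) (P.map (S 1)) (P.map (S 1)) := by
    refine ⟨by fun_prop, ?_⟩
    rw [Measure.map_map (by fun_prop) (hS.measurable 1)]
    exact hsymm.map_eq.symm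
  have hφ := hS.measurePreserving_increments
  have hmB := fun (B : Set ℝ) (hB : MeasurableSet B) => measurableSet_sum_fst_mem n hB
  have hmp := measurableSet_forall_sum_snd_mem n (measurableSet_Ioi (a := (0 : ℝ)))
  have hmn := measurableSet_forall_sum_snd_mem n (measurableSet_Ici (a := (0 : ℝ)))
  have haeB : ∀ B : Set ℝ, {ω | (S n ω).1 ∈ B} =ᵐ[P] (fun ω i => S (i + 1) ω - S i ω) ⁻¹'
      {d | (∑ i ∈ Finset.range n, d i).1 ∈ B} := fun B => by
    filter_upwards [hS.ae_eq_sum] with ω hω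
    refine propext ?_
    change (S n ω).1 ∈ B ↔ (∑ i ∈ Finset.range n, (S (i + 1) ω - S i ω)).1 ∈ B
    rw [← hω n]
  have haep : {ω | 0 < minSnd S n hn ω} =ᵐ[P] (fun ω i => S (i + 1) ω - S i ω) ⁻¹'
      {d | ∀ j ∈ Finset.Icc 1 n, (∑ i ∈ Finset.range j, d i).2 ∈ Set.Ioi 0} := by
    filter_upwards [hS.ae_eq_sum] with ω hω
    refine propext ((lt_minSnd_iff hn ω 0).trans (forall₂_congr fun j _ => ?_))
    change _ ↔ 0 < (∑ i ∈ Finset.range j, (S (i + 1) ω - S i ω)).2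
    rw [← hω j]
  have haen : {ω | 0 ≤ minSnd S n hn ω} =ᵐ[P] (fun ω i => S (i + 1) ω - S i ω) ⁻¹'
      {d | ∀ j ∈ Finset.Icc 1 n, (∑ i ∈ Finset.range j, d i).2 ∈ Set.Ici 0} := by
    filter_upwards [hS.ae_eq_sum] with ω hω
    refine propext ((le_minSnd_iff hn ω 0).trans (forall₂_congr fun j _ => ?_))
    change _ ↔ 0 ≤ (∑ i ∈ Finset.range j, (S (i + 1) ω - S i ω)).2
    rw [← hω j]
  have hPB := fun (B : Set ℝ) (hB : MeasurableSet B) =>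
    (measure_congr (haeB B)).trans (hφ.measure_preimage (hmB B hB).nullMeasurableSet)
  have hPp := (measure_congr haep).trans (hφ.measure_preimage hmp.nullMeasurableSet)
  have hPn := (measure_congr haen).trans (hφ.measure_preimage hmn.nullMeasurableSet)
  have hPBp := fun (B : Set ℝ) (hB : MeasurableSet B) =>
    (measure_congr ((haeB B).inter haep)).trans
      (hφ.measure_preimage ((hmB B hB).inter hmp).nullMeasurableSet)
  have hPBn := fun (B : Set ℝ) (hB : MeasurableSet B) =>
    (measure_congr ((haeB B).inter haen)).trans
      (hφ.measure_preimage ((hmB B hB).inter hmn).nullMeasurableSet)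
  have hlower : ∀ B : Set ℝ, MeasurableSet B →
      P {ω | (S n ω).1 ∈ B} * P {ω | 0 < minSnd S n hn ω}
        ≤ P ({ω | (S n ω).1 ∈ B} ∩ {ω | 0 ≤ minSnd S n hn ω}) := fun B hB => by
    obtain ⟨p, h1, -, h3, -⟩ := exists_mul_le_and_le_mul hrefl n hB
    rw [hPB B hB, hPp, hPBn B hB]
    exact (mul_le_mul_right h1 _).trans h3
  have hupper : ∀ B : Set ℝ, MeasurableSet B →
      P ({ω | (S n ω).1 ∈ B} ∩ {ω | 0 < minSnd S n hn ω})
        ≤ P {ω | (S n ω).1 ∈ B} * P {ω | 0 ≤ minSnd S n hn ω} := fun B hB => by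
    obtain ⟨p, -, h2, -, h4⟩ := exists_mul_le_and_le_mul hrefl n hB
    rw [hPB B hB, hPn, hPBp B hB]
    exact h4.trans (mul_le_mul_right h2 _)
  refine ⟨hlower, hupper, fun hatom B hB => ?_⟩
  have hatom' : ∀ a, (P.map (S 1)).map Prod.snd {a} = 0 := fun a => by
    rw [Measure.map_map measurable_snd (hS.measurable 1)]
    exact hatom a
  -- Without atoms no position has vanishing second coordinate, so weak and strict positivity
  -- coincide and the two inequalities become an equality.
  have hne : ∀ᵐ ω ∂P, ∀ j ∈ Finset.Icc 1 n, (S j ω).2 ≠ 0 := by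
    have h : ∀ᵐ d ∂(Measure.infinitePi fun _ : ℕ => P.map (S 1)), ∀ j : ℕ, 1 ≤ j →
        ∑ i ∈ Finset.range j, (d i).2 ≠ 0 := by
      simp only [ae_all_iff]
      exact fun j hj => infinitePi_ae_sum_ne_zero _ Prod.snd measurable_snd hatom' _
        (Finset.nonempty_range_iff.2 (by omega))
    filter_upwards [hφ.quasiMeasurePreserving.ae h, hS.ae_eq_sum] with ω h1 h2 j hj
    rw [h2 j, Prod.snd_sum]
    exact h1 j (Finset.mem_Icc.1 hj).1
  have hpn : {ω | 0 < minSnd S n hn ω} =ᵐ[P] {ω | 0 ≤ minSnd S n hn ω} := by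
    filter_upwards [hne] with ω hω
    refine propext (((lt_minSnd_iff hn ω 0).trans (forall₂_congr fun j hj => ?_)).trans
      (le_minSnd_iff hn ω 0).symm)
    exact ⟨le_of_lt, fun h => lt_of_le_of_ne h (hω j hj).symm⟩
  have hmS : MeasurableSet {ω | (S n ω).1 ∈ B} := (hS.measurable n).fst hB
  have hmMin : MeasurableSet {ω | 0 < minSnd S n hn ω} := by
    simp only [lt_minSnd_iff, Set.ofPred_forall]
    exact .iInter fun j => .iInter fun _ => (hS.measurable j).snd measurableSet_Ioi
  rw [indepSet_iff_measure_inter_eq_mul hmS hmMin P]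
  refine le_antisymm ?_ ?_
  · rw [measure_congr hpn]
    exact hupper B hB
  · rw [measure_congr ((Filter.EventuallyEq.refl _ {ω | (S n ω).1 ∈ B}).inter hpn)]
    exact hlower B hB
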